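/- A probabilistic weighted automaton $A=\langle Q,\rho_I,\Sigma,\delta,\gamma\rangle$ consists of a finite set $Q$ of states, an initial probability distribution $\rho_I$ on $Q$, a finite alphabet $\Sigma$, a probabilistic transition function $\delta$ assigning to every $(q,\sigma)\in Q\times\Sigma$ a probability distribution $\delta(q,\sigma)$ on $Q$, and a weight function $\gamma:Q\times\Sigma\times Q\to\mathbb{Q}$. A run of $A$ over an infinite word $w=\sigma_1\sigma_2\dots\in\Sigma^\omega$ is a state sequence $r=q_0q_1q_2\dots$ with $\rho_I(q_0)>0$ and $\delta(q_i,\sigma_{i+1})(q_{i+1})>0$ for all $i\ge 0$. Let $\mathbb{P}^A_w$ be the unique Borel probability measure on infinite state sequences for which, for all $k$, the sequences starting with $q_0,\dots,q_k$ have probability $\rho_I(q_0)\prod_{i=1}^{k}\delta(q_{i-1},\sigma_i)(q_i)$. For a discount factor $\lambda\in(0,1)$, the discounted sum of $r$ is $\mathsf{Disc}_\lambda(r)=\sum_{i\ge0}\lambda^i\,\gamma(q_i,\sigma_{i+1},q_{i+1})$. The value of $w$ is $$L^{>0}_A(w)=\sup\{\eta\in\mathbb{R}\mid \mathbb{P}^A_w(\{r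 \text{ a run over } w\mid \mathsf{Disc}_\lambda(r)\ge\eta\})>0\}$$ under the positive semantics (PosDisc), and $$L^{=1}_A(w)=\sup\{\eta\in\mathbb{R}\mid \mathbb{P}^A_w(\{r \text{ a run over } w\mid \mathsf{Disc}_\lambda(r)\ge\eta\})=1\}$$ under the almost-sure semantics (AsDisc). Theorem. The following two decision problems are decidable. In both, the input is a probabilistic weighted automaton $A$ with rational transition and initial probabilities, a rational discount factor $\lambda$ with $0<\lambda<1$, and a threshold $\nu\in\mathbb{Q}$ (all rational numbers being given by reduced numerator and denominator). 1. (Quantitative emptiness for PosDisc) Does there exist a word $w\in\Sigma^\omega$ with $L^{>0}_A(w)\ge\nu$? 2. (Quantitative universality for AsDisc) Does $L^{=1}_A(w)\ge\nu$ hold for all words $w\in\Sigma^\omega$? -/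

import Mathlib

open MeasureTheory ProbabilityTheory

/-! ### Probabilistic weighted automata -/

/-- A probabilistic weighted automaton with finite set of states `Q` and alphabet `S`: an initial
distribution on `Q`, a probabilistic transition function `Q × S → 𝒟(Q)` and a rational weight
function on `Q × S × Q`. Here `stdSimplex ℝ Q` is the set of probability distributions on `Q`. -/
structure ProbWeightedAutomaton (Q S : Type*) [Fintype Q] where
  init : Q → ℝ
  init_mem : init ∈ stdSimplex ℝ Q
  trans : Q → S → Q → ℝ
  trans_mem : ∀ q a, trans q a ∈ stdSimplex ℝ Q
  weight : Q → S → Q → ℚ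

/-- The probability mass function given by a probability vector on a finite set. -/
noncomputable def pmfOfSimplex {Q : Type*} [Fintype Q] (f : Q → ℝ) (hf : f ∈ stdSimplex ℝ Q) :
    PMF Q :=
  PMF.ofFintype (fun q => ENNReal.ofReal (f q)) (by
    rw [← ENNReal.ofReal_sum_of_nonneg (fun q _ => hf.1 q), hf.2, ENNReal.ofReal_one])

namespace ProbWeightedAutomaton

variable {Q S : Type*} [Fintype Q]

/-- The state sequence `r 0, r 1, …` is a run over the infinite word `w 0, w 1, …`. -/
def IsRun (A : ProbWeightedAutomaton Q S) (w : ℕ → S) (r : ℕ → Q) : Prop :=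
  0 < A.init (r 0) ∧ ∀ i, 0 < A.trans (r i) (w i) (r (i + 1))

/-- The sequence of weights that occur in the run `r` over the word `w`. -/
def weights (A : ProbWeightedAutomaton Q S) (w : ℕ → S) (r : ℕ → Q) (i : ℕ) : ℚ :=
  A.weight (r i) (w i) (r (i + 1))

section Semantics

variable [MeasurableSpace Q] [DiscreteMeasurableSpace Q]

/-- The Markov kernel `q ↦ δ(q, a)`. -/
noncomputable def letterKernel (A : ProbWeightedAutomaton Q S) (a : S) : Kernel Q Q :=
  Kernel.ofFunOfCountable fun q => (pmfOfSimplex (A.trans q a) (A.trans_mem q a)).toMeasure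

instance (A : ProbWeightedAutomaton Q S) (a : S) : IsMarkovKernel (A.letterKernel a) where
  isProbabilityMeasure q := by
    change IsProbabilityMeasure (pmfOfSimplex (A.trans q a) (A.trans_mem q a)).toMeasure
    infer_instance

/-- The kernel that maps a history `q₀, …, qₙ` to the distribution `δ(qₙ, wₙ)` of the next state. -/
noncomputable def stepKernel (A : ProbWeightedAutomaton Q S) (w : ℕ → S) (n : ℕ) :
    Kernel (Finset.Iic n → Q) Q :=
  (A.letterKernel (w n)).comap (fun h => h ⟨n, Finset.mem_Iic.2 le_rfl⟩) (measurable_pi_apply _)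

instance (A : ProbWeightedAutomaton Q S) (w : ℕ → S) (n : ℕ) :
    IsMarkovKernel (A.stepKernel w n) := by
  unfold stepKernel; infer_instance

/-- The probability measure `ℙ^A` on infinite state sequences, for the input word `w`. -/
noncomputable def runMeasure (A : ProbWeightedAutomaton Q S) (w : ℕ → S) : Measure (ℕ → Q) :=
  Kernel.trajMeasure (X := fun _ => Q) (pmfOfSimplex A.init A.init_mem).toMeasure (A.stepKernel w)

/-- The measure `ℙ^A` gives each finite run its probability; this determines it uniquely. -/
theorem runMeasure_cylinder (A : ProbWeightedAutomaton Q S) (w : ℕ → S) (s : ℕ → Q) (k : ℕ) :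
    A.runMeasure w {r | ∀ i ≤ k, r i = s i} =
      ENNReal.ofReal (A.init (s 0) * ∏ i ∈ Finset.range k, A.trans (s i) (w i) (s (i + 1))) := by
  classical
  induction k with
  | zero =>
    have h : (A.runMeasure w).map (Preorder.frestrictLe 0) =
      ((pmfOfSimplex A.init A.init_mem).toMeasure).map (MeasurableEquiv.piUnique (fun _ : Finset.Iic 0 => Q)).symm := by
      rw [runMeasure, Kernel.trajMeasure, Measure.map_comp _ _ (by fun_prop),
        Kernel.traj_map_frestrictLe, Kernel.partialTraj_self, Measure.id_comp]
    have h2 : (A.runMeasure w).map (fun r => r 0) = (pmfOfSimplex A.init A.init_mem).toMeasure := by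
      have : (fun r : ℕ → Q => r 0) = (fun g : Finset.Iic 0 → Q => g ⟨0, by simp⟩) ∘ Preorder.frestrictLe 0 := rfl
      rw [this, ← Measure.map_map (by fun_prop) (by fun_prop), h, Measure.map_map (by fun_prop) (by fun_prop)]
      have e : (fun g : Finset.Iic 0 → Q => g ⟨0, by simp⟩) ∘ (MeasurableEquiv.piUnique (fun _ : Finset.Iic 0 => Q)).symm = id := by
        funext q
        exact (MeasurableEquiv.piUnique (fun _ : Finset.Iic 0 => Q)).apply_symm_apply q
      rw [e, Measure.map_id]
    have : {r : ℕ → Q | ∀ i ≤ 0, r i = s i} = (fun r => r 0) ⁻¹' {s 0} := by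
      ext r; simp
    rw [this, ← Measure.map_apply (by fun_prop) (measurableSet_singleton _), h2,
      PMF.toMeasure_apply_singleton _ _ (measurableSet_singleton _)]
    simp [pmfOfSimplex]
  | succ k ih =>
    have h := @Kernel.map_frestrictLe_trajMeasure_compProd_eq_map_trajMeasure (fun _ => Q) _
      (A.stepKernel w) _ (pmfOfSimplex A.init A.init_mem).toMeasure _ k
    change (A.runMeasure w).map _ ⊗ₘ _ = (A.runMeasure w).map _ at h
    let c : Finset.Iic k → Q := fun i => s i
    have h1 : {r : ℕ → Q | ∀ i ≤ k + 1, r i = s i} =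
        (fun x : ℕ → Q => (Preorder.frestrictLe k x, x (k+1))) ⁻¹' ({c} ×ˢ {s (k+1)}) := by
      ext r
      simp only [Set.mem_ofPred_eq, Set.mem_preimage, Set.mem_prod, Set.mem_singleton_iff, c, funext_iff]
      constructor
      · intro h
        exact ⟨fun i => h i (by have := Finset.mem_Iic.1 i.2; omega), h _ le_rfl⟩
      · rintro ⟨h, h'⟩ i hi
        rcases Nat.lt_or_ge k i with h2 | h2
        · obtain rfl : i = k + 1 := by omega
          exact h'
        · exact h ⟨i, by simpa using h2⟩
    have h3 : {r : ℕ → Q | ∀ i ≤ k, r i = s i} = (Preorder.frestrictLe (π := fun _ => Q) k) ⁻¹' {c} := by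
      ext r
      simp only [Set.mem_ofPred_eq, Set.mem_preimage, Set.mem_singleton_iff, c, funext_iff]
      exact ⟨fun h i => h i (Finset.mem_Iic.1 i.2), fun h i hi => h ⟨i, by simpa using hi⟩⟩
    rw [h1, ← Measure.map_apply (by fun_prop) (by measurability), ← h,
      Measure.compProd_apply_prod (by measurability) (by measurability),
      lintegral_singleton, Measure.map_apply (by fun_prop) (by measurability), ← h3, ih]
    have hp : 0 ≤ A.init (s 0) * ∏ i ∈ Finset.range k, A.trans (s i) (w i) (s (i + 1)) :=
      mul_nonneg (A.init_mem.1 _) (Finset.prod_nonneg fun i _ => (A.trans_mem _ _).1 _)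
    have hk : (A.stepKernel w k c) {s (k + 1)} = ENNReal.ofReal (A.trans (s k) (w k) (s (k + 1))) := by
      rw [stepKernel, Kernel.comap_apply]
      change (pmfOfSimplex (A.trans (s k) (w k)) _).toMeasure _ = _
      rw [PMF.toMeasure_apply_singleton _ _ (measurableSet_singleton _)]
      rfl
    rw [hk, Finset.prod_range_succ, ← mul_assoc, ENNReal.ofReal_mul hp, mul_comm]

/-- The value of the word `w` under the positive semantics, for the value function `Val`. -/
noncomputable def posValue (A : ProbWeightedAutomaton Q S) (Val : (ℕ → ℚ) → ℝ) (w : ℕ → S) : ℝ :=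
  sSup {η : ℝ | 0 < A.runMeasure w {r | A.IsRun w r ∧ η ≤ Val (A.weights w r)}}

/-- The value of the word `w` under the almost-sure semantics, for the value function `Val`. -/
noncomputable def asValue (A : ProbWeightedAutomaton Q S) (Val : (ℕ → ℚ) → ℝ) (w : ℕ → S) : ℝ :=
  sSup {η : ℝ | A.runMeasure w {r | A.IsRun w r ∧ η ≤ Val (A.weights w r)} = 1}

end Semantics

end ProbWeightedAutomaton

/-- The discounted sum `∑ᵢ cⁱ vᵢ` with discount factor `c`. -/
noncomputable def discSum (c : ℝ) (v : ℕ → ℚ) : ℝ := ∑' i, c ^ i * (v i : ℝ)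

/-! ### Instances of the decision problems and their encoding -/

/-- An instance of the quantitative decision problems for discounted-sum automata: a probabilistic
weighted automaton with states `Fin numStates`, letters `Fin numLetters` and rational
probabilities, a rational discount factor in `(0, 1)`, and a rational threshold. -/
structure DiscInstance where
  numStates : ℕ
  numLetters : ℕ
  init : Fin numStates → ℚ
  init_mem : init ∈ stdSimplex ℚ (Fin numStates)
  trans : Fin numStates → Fin numLetters → Fin numStates → ℚ
  trans_mem : ∀ q a, trans q a ∈ stdSimplex ℚ (Fin numStates)
  weight : Fin numStates → Fin numLetters → Fin numStates → ℚ
  discount : ℚ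
  discount_pos : 0 < discount
  discount_lt_one : discount < 1
  threshold : ℚ

theorem cast_mem_stdSimplex {Q : Type*} [Fintype Q] {f : Q → ℚ} (hf : f ∈ stdSimplex ℚ Q) :
    (fun q => (f q : ℝ)) ∈ stdSimplex ℝ Q :=
  ⟨fun q => Rat.cast_nonneg.2 (hf.1 q), by simpa using congrArg (Rat.cast : ℚ → ℝ) hf.2⟩

/-- A rational number is written as its reduced numerator and denominator. -/
def ratCode (x : ℚ) : ℤ × ℕ := (x.num, x.den)

theorem ratCode_injective : Function.Injective ratCode := fun _ _ h =>
  Rat.ext (congrArg Prod.fst h) (congrArg Prod.snd h)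

/-- Input strings: number of states, number of letters, initial distribution, transition
probabilities and weights (as nested lists), discount factor, threshold. -/
abbrev DiscCode : Type :=
  (ℕ × ℕ) × (List (ℤ × ℕ) × List (List (List (ℤ × ℕ))) × List (List (List (ℤ × ℕ)))) ×
    ((ℤ × ℕ) × (ℤ × ℕ))

/-- The table of a rational function on `Q × S × Q` as a nested list. -/
def tableCode {n m : ℕ} (t : Fin n → Fin m → Fin n → ℚ) : List (List (List (ℤ × ℕ))) :=
  List.ofFn fun q => List.ofFn fun a => List.ofFn fun q' => ratCode (t q a q')

theorem tableCode_injective {n m : ℕ} :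
    Function.Injective (tableCode : (Fin n → Fin m → Fin n → ℚ) → _) := by
  intro t t' h
  funext q a q'
  have h1 := congrFun (List.ofFn_injective h) q
  have h2 := congrFun (List.ofFn_injective h1) a
  have h3 := congrFun (List.ofFn_injective h2) q'
  exact ratCode_injective h3

namespace DiscInstance

/-- The probabilistic weighted automaton of an instance. -/
def automaton (x : DiscInstance) :
    ProbWeightedAutomaton (Fin x.numStates) (Fin x.numLetters) where
  init q := (x.init q : ℝ)
  init_mem := cast_mem_stdSimplex x.init_mem
  trans q a q' := (x.trans q a q' : ℝ)
  trans_mem q a := cast_mem_stdSimplex (x.trans_mem q a)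
  weight := x.weight

/-- The finite description of an instance that is given to an algorithm. -/
def encode (x : DiscInstance) : DiscCode :=
  ((x.numStates, x.numLetters),
    (List.ofFn fun q => ratCode (x.init q), tableCode x.trans, tableCode x.weight),
    (ratCode x.discount, ratCode x.threshold))

theorem encode_injective : Function.Injective encode := by
  rintro ⟨n, m, i, hi, t, ht, g, c, hc, hc', v⟩ ⟨n', m', i', hi', t', ht', g', d, hd, hd', v'⟩ h
  simp only [encode, Prod.mk.injEq] at h
  obtain ⟨⟨rfl, rfl⟩, ⟨h1, h2, h3⟩, h4, h5⟩ := h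
  obtain rfl : i = i' := by
    funext q
    exact ratCode_injective (congrFun (List.ofFn_injective h1) q)
  obtain rfl := tableCode_injective h2
  obtain rfl := tableCode_injective h3
  obtain rfl := ratCode_injective h4
  obtain rfl := ratCode_injective h5
  rfl

/-- Some infinite word has value at least the threshold under the positive semantics. -/
def PosNonempty (x : DiscInstance) : Prop :=
  ∃ w : ℕ → Fin x.numLetters, (x.threshold : ℝ) ≤ x.automaton.posValue (discSum x.discount) w

/-- All infinite words have value at least the threshold under the almost-sure semantics. -/
def AsUniversal (x : DiscInstance) : Prop :=
  ∀ w : ℕ → Fin x.numLetters, (x.threshold : ℝ) ≤ x.automaton.asValue (discSum x.discount) w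

/-- A decision problem on instances is decidable if the set of encodings of its positive instances
is a computable (recursive) set. -/
def DecidableProblem (P : DiscInstance → Prop) : Prop :=
  ComputablePred fun c : DiscCode => ∃ x : DiscInstance, x.encode = c ∧ P x

end DiscInstance

/-!
Under the measure of a word `w`, a finite run has positive probability exactly if all its steps do,
so the runs over `w` form the topological support of that measure. The discounted sum is continuous
on the compact space of state sequences. Hence the value of `w` is the maximum of the discounted sum
over the runs under the positive semantics and its minimum under the almost-sure semantics, and both
problems compare the threshold with the optimal discounted sum of infinite paths in a finite graph,
where minimizing amounts to maximizing for the negated weights. The optimal values solve a Bellman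
equation. It has a rational solution, the value of a best memoryless policy, and every solution
gives the optimal values. So a solution can be found by unbounded search among rational vectors,
each of which is checked exactly, and the answer is read off from it.
-/

/-! ### Primitive recursive arithmetic on `ℤ` -/

theorem encode_int_natCast (n : ℕ) : Encodable.encode (n : ℤ) = 2 * n := rfl

theorem encode_int_negSucc (n : ℕ) : Encodable.encode (Int.negSucc n) = 2 * n + 1 := rfl

theorem primrec_int_toNat : Primrec Int.toNat := by
  have h : Primrec fun z : ℤ =>
      if Encodable.encode z % 2 = 0 then Encodable.encode z / 2 else 0 :=
    .ite (Primrec.eq.comp (Primrec.nat_mod.comp .encode (.const 2)) (.const 0))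
      (Primrec.nat_div.comp .encode (.const 2)) (.const 0)
  refine h.of_eq fun z => ?_
  cases z with
  | ofNat n => simp [encode_int_natCast]
  | negSucc n => rw [encode_int_negSucc, if_neg (by omega), Int.toNat_negSucc]

theorem primrec_int_neg_toNat : Primrec fun z : ℤ => (-z).toNat := by
  have h : Primrec fun z : ℤ =>
      if Encodable.encode z % 2 = 0 then 0 else Encodable.encode z / 2 + 1 :=
    .ite (Primrec.eq.comp (Primrec.nat_mod.comp .encode (.const 2)) (.const 0)) (.const 0)
      (Primrec.succ.comp (Primrec.nat_div.comp .encode (.const 2)))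
  refine h.of_eq fun z => ?_
  cases z with
  | ofNat n => simp [encode_int_natCast]
  | negSucc n => rw [encode_int_negSucc, if_neg (by omega), Int.negSucc_eq]; omega

theorem primrec_nat_sub_int : Primrec₂ fun a b : ℕ => (a : ℤ) - b := by
  have h : Primrec₂ fun a b : ℕ => if b ≤ a then 2 * (a - b) else 2 * (b - a - 1) + 1 :=
    .ite (Primrec.nat_le.comp .snd .fst) (Primrec.nat_double.comp (Primrec.nat_sub.comp .fst .snd))
      (Primrec.nat_double_succ.comp
        (Primrec.nat_sub.comp (Primrec.nat_sub.comp .snd .fst) (.const 1)))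
  refine Primrec₂.encode_iff.1 (h.of_eq fun a b => ?_)
  by_cases hab : b ≤ a
  · rw [if_pos hab, ← encode_int_natCast, Nat.cast_sub hab]
  · rw [if_neg hab, ← encode_int_negSucc, Int.negSucc_eq]
    congr 1
    omega

theorem primrec_int_add : Primrec₂ ((· + ·) : ℤ → ℤ → ℤ) :=
  (primrec_nat_sub_int.comp
    (Primrec.nat_add.comp (primrec_int_toNat.comp .fst) (primrec_int_toNat.comp .snd))
    (Primrec.nat_add.comp (primrec_int_neg_toNat.comp .fst)
      (primrec_int_neg_toNat.comp .snd))).to₂.of_eq fun a b => by dsimp only; omega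

theorem primrec_int_mul : Primrec₂ ((· * ·) : ℤ → ℤ → ℤ) := by
  have pos_fst := primrec_int_toNat.comp (Primrec.fst (α := ℤ) (β := ℤ))
  have neg_fst := primrec_int_neg_toNat.comp (Primrec.fst (α := ℤ) (β := ℤ))
  have pos_snd := primrec_int_toNat.comp (Primrec.snd (α := ℤ) (β := ℤ))
  have neg_snd := primrec_int_neg_toNat.comp (Primrec.snd (α := ℤ) (β := ℤ))
  refine (primrec_nat_sub_int.comp
    (Primrec.nat_add.comp (Primrec.nat_mul.comp pos_fst pos_snd)
      (Primrec.nat_mul.comp neg_fst neg_snd))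
    (Primrec.nat_add.comp (Primrec.nat_mul.comp pos_fst neg_snd)
      (Primrec.nat_mul.comp neg_fst pos_snd))).to₂.of_eq fun a b => ?_
  conv_rhs => rw [← Int.toNat_sub_toNat_neg a, ← Int.toNat_sub_toNat_neg b]
  push_cast
  ring

theorem primrecRel_int_le : PrimrecRel ((· ≤ ·) : ℤ → ℤ → Prop) :=
  (Primrec.nat_le.comp
    (Primrec.nat_add.comp (primrec_int_toNat.comp .fst) (primrec_int_neg_toNat.comp .snd))
    (Primrec.nat_add.comp (primrec_int_toNat.comp .snd)
      (primrec_int_neg_toNat.comp .fst))).of_eq fun p => by omega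

theorem primrec_natCast_int : Primrec fun n : ℕ => (n : ℤ) :=
  (primrec_nat_sub_int.comp .id (.const 0)).of_eq fun n => by simp

theorem primrec_int_natAbs : Primrec Int.natAbs :=
  (Primrec.nat_add.comp primrec_int_toNat primrec_int_neg_toNat).of_eq fun z => by omega

theorem primrec_int_tdiv_natCast : Primrec₂ fun (z : ℤ) (n : ℕ) => z.tdiv n :=
  (primrec_nat_sub_int.comp (Primrec.nat_div.comp (primrec_int_toNat.comp .fst) .snd)
    (Primrec.nat_div.comp (primrec_int_neg_toNat.comp .fst) .snd)).to₂.of_eq fun z n => by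
      obtain ⟨k, rfl | rfl⟩ := z.eq_nat_or_neg <;> simp [Int.neg_tdiv]

theorem primrec_nat_gcd : Primrec₂ Nat.gcd := by
  have dvd : PrimrecRel fun k n : ℕ => k ∣ n :=
    (Primrec.eq.comp (Primrec.nat_mod.comp .snd .fst) (.const 0)).of_eq fun p =>
      Nat.dvd_iff_mod_eq_zero.symm
  have common_dvd : PrimrecRel fun (p : ℕ × ℕ) k => k ∣ p.1 ∧ k ∣ p.2 :=
    (dvd.comp .snd (Primrec.fst.comp .fst)).and (dvd.comp .snd (Primrec.snd.comp .fst))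
  refine (Primrec.nat_findGreatest (Primrec.nat_add.comp .fst .snd) common_dvd).to₂.of_eq
    fun a b => ?_
  dsimp only
  refine Nat.findGreatest_eq_iff.2
    ⟨?_, fun _ => ⟨Nat.gcd_dvd_left _ _, Nat.gcd_dvd_right _ _⟩, fun n hlt hle hn => ?_⟩
  · obtain rfl | ha := Nat.eq_zero_or_pos a
    · simp
    · exact (Nat.gcd_le_left b ha).trans (Nat.le_add_right _ _)
  · refine hlt.not_ge (Nat.le_of_dvd (Nat.gcd_pos_iff.2 ?_) (Nat.dvd_gcd hn.1 hn.2))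
    omega

/-! ### Primitive recursive arithmetic on `ℚ` -/

/-- The pairs that consist of the reduced numerator and denominator of a rational number, that is,
the range of `ratCode`. -/
def IsReducedFraction (p : ℤ × ℕ) : Prop := p.2 ≠ 0 ∧ p.1.natAbs.Coprime p.2

instance : DecidablePred IsReducedFraction := fun _ => inferInstanceAs (Decidable (_ ∧ _))

theorem primrecPred_isReducedFraction : PrimrecPred IsReducedFraction :=
  (PrimrecPred.not (Primrec.eq.comp .snd (.const 0))).and
    (Primrec.eq.comp (primrec_nat_gcd.comp (primrec_int_natAbs.comp .fst) .snd) (.const 1))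

/-- A rational number as a reduced fraction; the equivalence through which `ℚ` becomes
`Primcodable`, so that computing with a rational number is computing with its `ratCode`. -/
def ratEquivReduced : ℚ ≃ {p : ℤ × ℕ // IsReducedFraction p} where
  toFun x := ⟨ratCode x, x.den_nz, x.reduced⟩
  invFun p := ⟨p.1.1, p.1.2, p.2.1, p.2.2⟩
  left_inv _ := rfl
  right_inv _ := rfl

instance : Primcodable ℚ :=
  letI := Primcodable.subtype primrecPred_isReducedFraction
  Primcodable.ofEquiv _ ratEquivReduced

theorem primrec_ratCode_comp_iff {α : Type*} [Primcodable α] {f : α → ℚ} :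
    (Primrec fun a => ratCode (f a)) ↔ Primrec f := by
  let := Primcodable.subtype primrecPred_isReducedFraction
  rw [← Primrec.of_equiv_iff ratEquivReduced]
  exact Primrec.subtype_val_iff (hp := primrecPred_isReducedFraction)
    (f := fun a => ratEquivReduced (f a))

theorem primrec_ratCode : Primrec ratCode := primrec_ratCode_comp_iff.2 .id

theorem primrec_rat_num : Primrec Rat.num := Primrec.fst.comp primrec_ratCode

theorem primrec_rat_den : Primrec Rat.den := Primrec.snd.comp primrec_ratCode

theorem ratCode_mkRat {b : ℕ} (hb : b ≠ 0) (a : ℤ) :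
    ratCode (mkRat a b) = (a.tdiv (a.natAbs.gcd b), b / a.natAbs.gcd b) := by
  have hdvd : ((a.natAbs.gcd b : ℕ) : ℤ) ∣ a := Int.natCast_dvd.2 (Nat.gcd_dvd_left _ _)
  rw [← Rat.normalize_eq_mkRat hb, Rat.normalize_eq, ratCode, Int.tdiv_eq_ediv_of_dvd hdvd]

theorem primrec_mkRat : Primrec₂ mkRat := by
  have gcd : Primrec fun p : ℤ × ℕ => p.1.natAbs.gcd p.2 :=
    primrec_nat_gcd.comp (primrec_int_natAbs.comp .fst) .snd
  have h : Primrec fun p : ℤ × ℕ => if p.2 = 0 then ((0, 1) : ℤ × ℕ) else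
      (p.1.tdiv (p.1.natAbs.gcd p.2), p.2 / p.1.natAbs.gcd p.2) :=
    .ite (Primrec.eq.comp .snd (.const 0)) (.const _)
      (.pair (primrec_int_tdiv_natCast.comp .fst gcd) (Primrec.nat_div.comp .snd gcd))
  refine primrec_ratCode_comp_iff.1 (h.of_eq fun ⟨a, b⟩ => ?_)
  split_ifs with hb
  · obtain rfl : b = 0 := hb
    simp [ratCode]
  · exact (ratCode_mkRat hb a).symm

theorem primrec_rat_add : Primrec₂ ((· + ·) : ℚ → ℚ → ℚ) :=
  (primrec_mkRat.comp
    (primrec_int_add.comp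
      (primrec_int_mul.comp (primrec_rat_num.comp .fst)
        (primrec_natCast_int.comp (primrec_rat_den.comp .snd)))
      (primrec_int_mul.comp (primrec_rat_num.comp .snd)
        (primrec_natCast_int.comp (primrec_rat_den.comp .fst))))
    (Primrec.nat_mul.comp (primrec_rat_den.comp .fst) (primrec_rat_den.comp .snd))).to₂.of_eq
      fun a b => (Rat.add_def' a b).symm

theorem primrec_rat_mul : Primrec₂ ((· * ·) : ℚ → ℚ → ℚ) :=
  (primrec_mkRat.comp
    (primrec_int_mul.comp (primrec_rat_num.comp .fst) (primrec_rat_num.comp .snd))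
    (Primrec.nat_mul.comp (primrec_rat_den.comp .fst) (primrec_rat_den.comp .snd))).to₂.of_eq
      fun a b => (Rat.mul_def' a b).symm

theorem primrecRel_rat_le : PrimrecRel ((· ≤ ·) : ℚ → ℚ → Prop) :=
  (primrecRel_int_le.comp
    (primrec_int_mul.comp (primrec_rat_num.comp .fst)
      (primrec_natCast_int.comp (primrec_rat_den.comp .snd)))
    (primrec_int_mul.comp (primrec_rat_num.comp .snd)
      (primrec_natCast_int.comp (primrec_rat_den.comp .fst)))).of_eq fun p =>
      (Rat.le_iff p.1 p.2).symm

theorem primrecRel_rat_lt : PrimrecRel ((· < ·) : ℚ → ℚ → Prop) :=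
  (PrimrecPred.not (primrecRel_rat_le.comp .snd .fst)).of_eq fun _ => not_le

/-! ### Finite families and unbounded search -/

theorem primrecPred_imp {α : Type*} [Primcodable α] {p q : α → Prop} (hp : PrimrecPred p)
    (hq : PrimrecPred q) : PrimrecPred fun a => p a → q a :=
  (hp.not.or hq).of_eq fun _ => imp_iff_not_or.symm

section FiniteFamilies

variable {α β : Type*} [Primcodable α] [Primcodable β] {n : α → ℕ}

theorem primrec_list_ofFn {f : α → ℕ → β} (hn : Primrec n) (hf : Primrec₂ f) :
    Primrec fun a => List.ofFn fun i : Fin (n a) => f a i :=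
  (Primrec.list_map (Primrec.list_range.comp hn) hf).of_eq fun a =>
    List.ext_getElem (by simp) fun i _ _ => by simp

theorem primrecPred_forall_fin {p : α × ℕ → Prop} (hn : Primrec n) (hp : PrimrecPred p) :
    PrimrecPred fun a => ∀ i : Fin (n a), p (a, i) :=
  (PrimrecRel.forall_mem_list (R := fun i a => p (a, i)) (hp.comp (.pair .snd .fst))
    |>.comp (Primrec.list_range.comp hn) .id).of_eq fun a => by simp [Fin.forall_iff]

theorem primrecPred_exists_fin {p : α × ℕ → Prop} (hn : Primrec n) (hp : PrimrecPred p) :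
    PrimrecPred fun a => ∃ i : Fin (n a), p (a, i) :=
  (PrimrecRel.exists_mem_list (R := fun i a => p (a, i)) (hp.comp (.pair .snd .fst))
    |>.comp (Primrec.list_range.comp hn) .id).of_eq fun a => by simp [Fin.exists_iff]

theorem primrec_sum_fin {f : α → ℕ → ℚ} (hn : Primrec n) (hf : Primrec₂ f) :
    Primrec fun a => ∑ i : Fin (n a), f a i :=
  (Primrec.list_foldr (primrec_list_ofFn hn hf) (.const 0)
    (primrec_rat_add.comp (Primrec.fst.comp .snd) (Primrec.snd.comp .snd)).to₂).of_eq fun _ =>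
      List.sum_ofFn

theorem primrecPred_mem_stdSimplex {f : α → ℕ → ℚ} (hn : Primrec n) (hf : Primrec₂ f) :
    PrimrecPred fun a => (fun i : Fin (n a) => f a i) ∈ stdSimplex ℚ (Fin (n a)) :=
  (primrecPred_forall_fin (p := fun p => 0 ≤ f p.1 p.2) hn
    (primrecRel_rat_le.comp (.const 0) hf)).and
    (Primrec.eq.comp (primrec_sum_fin hn hf) (.const 1))

end FiniteFamilies

/-- The algorithm searches for a witness `b` with `R a b` and reads the answer off the first one. -/
theorem computablePred_of_search {α β : Type*} [Primcodable α] [Primcodable β] [Inhabited β]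
    {p : α → Prop} {R T : α → β → Prop} (hR : PrimrecRel R) (hT : PrimrecRel T)
    (hex : ∀ a, ∃ b, R a b) (h : ∀ a b, R a b → (p a ↔ T a b)) : ComputablePred p := by
  classical
  let candidate : ℕ → β := fun n => (Encodable.decode n : Option β).getD default
  have hc : Primrec candidate := Primrec.option_getD_default.comp .decode
  have hex' : ∀ a, ∃ n, R a (candidate n) := fun a =>
    (hex a).imp' Encodable.encode fun b hb => by simpa [candidate] using hb
  have hRc : PrimrecRel fun a n => R a (candidate n) := hR.comp .fst (hc.comp .snd)
  have hTc : PrimrecRel fun a n => T a (candidate n) := hT.comp .fst (hc.comp .snd)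
  have hfind := Computable.find hRc.computablePred hex'
  exact Computable.computablePred ((hTc.decide.to_comp.comp .id hfind).of_eq fun a =>
    decide_eq_decide.2 (h a _ (Nat.find_spec (hex' a))).symm)

/-! ### The Bellman equation -/

section Bellman

variable {Q S 𝕜 : Type*} [Field 𝕜] [LinearOrder 𝕜]

/-- `V` solves the Bellman equation `V q = max {W q a q' + c * V q' | E q a q'}` of the weighted
graph with edges `E`, labels in `S` and weights `W`, for the discount factor `c`. The maximum is
spelled out as an upper bound that is attained, so that the equation can be checked edge by edge. -/
def IsMaxPotential (E : Q → S → Q → Prop) (W : Q → S → Q → 𝕜) (c : 𝕜) (V : Q → 𝕜) : Prop :=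
  (∀ q a q', E q a q' → W q a q' + c * V q' ≤ V q) ∧
    ∀ q, ∃ a q', E q a q' ∧ V q = W q a q' + c * V q'

theorem IsMaxPotential.exists_path {E : Q → S → Q → Prop} {W : Q → S → Q → 𝕜} {c : 𝕜}
    {V : Q → 𝕜} (hV : IsMaxPotential E W c V) (q : Q) :
    ∃ (w : ℕ → S) (r : ℕ → Q), r 0 = q ∧ (∀ i, E (r i) (w i) (r (i + 1))) ∧
      ∀ i, V (r i) = W (r i) (w i) (r (i + 1)) + c * V (r (i + 1)) := by
  choose a s hE hVs using hV.2
  refine ⟨fun i => a (s^[i] q), fun i => s^[i] q, rfl, fun i => ?_, fun i => ?_⟩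
  · simpa only [Function.iterate_succ_apply'] using hE (s^[i] q)
  · simpa only [Function.iterate_succ_apply'] using hVs (s^[i] q)

variable [IsStrictOrderedRing 𝕜] [Finite Q] {c : 𝕜}

theorem nonpos_of_le_mul_comp (h0 : 0 ≤ c) (h1 : c < 1) {s : Q → Q} {f : Q → 𝕜}
    (h : ∀ q, f q ≤ c * f (s q)) (q : Q) : f q ≤ 0 := by
  have : Nonempty Q := ⟨q⟩
  obtain ⟨m, hm⟩ := Finite.exists_max f
  have hle : f m ≤ c * f m := (h m).trans (mul_le_mul_of_nonneg_left (hm _) h0)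
  exact (hm q).trans (by nlinarith)

theorem eq_zero_of_eq_mul_comp (h0 : 0 ≤ c) (h1 : c < 1) {s : Q → Q} {f : Q → 𝕜}
    (h : ∀ q, f q = c * f (s q)) : f = 0 :=
  funext fun q => le_antisymm (nonpos_of_le_mul_comp h0 h1 (fun q => (h q).le) q)
    (neg_nonpos.1 (nonpos_of_le_mul_comp (f := fun q => -f q) h0 h1
      (fun q => (by rw [h q, mul_neg] : -f q = c * -f (s q)).le) q))

theorem exists_eq_add_mul_comp (h0 : 0 ≤ c) (h1 : c < 1) (g : Q → 𝕜) (s : Q → Q) :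
    ∃ V : Q → 𝕜, ∀ q, V q = g q + c * V (s q) := by
  let T : (Q → 𝕜) →ₗ[𝕜] (Q → 𝕜) := LinearMap.id - c • LinearMap.funLeft 𝕜 𝕜 s
  have hT : ∀ V q, T V q = V q - c * V (s q) := fun V q => by simp [T, LinearMap.funLeft_apply]
  have hinj : Function.Injective T := (injective_iff_map_eq_zero T).2 fun V hV =>
    eq_zero_of_eq_mul_comp h0 h1 fun q => sub_eq_zero.1 (by rw [← hT, hV, Pi.zero_apply])
  obtain ⟨V, hV⟩ := LinearMap.surjective_of_injective hinj g
  exact ⟨V, fun q => sub_eq_iff_eq_add.1 (by rw [← hT, hV])⟩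

theorem le_of_le_add_mul_comp (h0 : 0 ≤ c) (h1 : c < 1) {g V V' : Q → 𝕜} {s : Q → Q}
    (hV : ∀ q, V q ≤ g q + c * V (s q)) (hV' : ∀ q, V' q = g q + c * V' (s q)) (q : Q) :
    V q ≤ V' q :=
  sub_nonpos.1 (nonpos_of_le_mul_comp (f := fun q => V q - V' q) (s := s) h0 h1
    (fun q => by linarith [hV q, hV' q]) q)

/-- Among the memoryless policies choose one with the largest total value: if the value violated an
inequality of the Bellman equation at some edge, then switching to that edge would increase it. -/
theorem exists_isMaxPotential [Finite S] (h0 : 0 ≤ c) (h1 : c < 1) {E : Q → S → Q → Prop}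
    (W : Q → S → Q → 𝕜) (hE : ∀ q, ∃ a q', E q a q') : ∃ V, IsMaxPotential E W c V := by
  classical
  cases nonempty_fintype Q
  let Policy := {σ : Q → S × Q // ∀ q, E q (σ q).1 (σ q).2}
  have : Nonempty Policy := by
    choose a q' h using hE
    exact ⟨fun q => (a q, q' q), h⟩
  choose V hV using fun σ : Policy =>
    exists_eq_add_mul_comp h0 h1 (fun q => W q (σ.1 q).1 (σ.1 q).2) fun q => (σ.1 q).2
  obtain ⟨σ, hσ⟩ := Finite.exists_max fun σ : Policy => ∑ q, V σ q
  refine ⟨V σ, fun p a p' hp => ?_, fun q => ⟨_, _, σ.2 q, hV σ q⟩⟩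
  by_contra! hlt
  let τ : Policy := ⟨Function.update σ.1 p (a, p'), fun q => by
    obtain rfl | hq := eq_or_ne q p
    · simpa using hp
    · simpa [hq] using σ.2 q⟩
  have improves : ∀ q, V σ q ≤ W q (τ.1 q).1 (τ.1 q).2 + c * V σ (τ.1 q).2 := fun q => by
    obtain rfl | hq := eq_or_ne q p
    · simpa [τ] using hlt.le
    · simpa [τ, hq] using (hV σ q).le
  have hle : ∀ q, V σ q ≤ V τ q := le_of_le_add_mul_comp h0 h1 improves (hV τ)
  have hlt' : V σ p < V τ p := by
    have hτ : V τ p = W p a p' + c * V τ p' := by simpa [τ] using hV τ p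
    exact hlt.trans_le (hτ ▸ by gcongr; exact hle p')
  exact (hσ τ).not_gt (Finset.sum_lt_sum (fun q _ => hle q) ⟨p, Finset.mem_univ _, hlt'⟩)

end Bellman

/-! ### Discounted sums -/

section DiscountedSum

theorem summable_pow_mul_comp {X : Type*} [Finite X] {c : ℝ} (hc : |c| < 1) (g : X → ℝ)
    (x : ℕ → X) : Summable fun i => c ^ i * g (x i) := by
  obtain ⟨C, hC⟩ := (Set.finite_range g).isBounded.exists_norm_le
  refine .of_norm_bounded ((summable_geometric_of_lt_one (abs_nonneg c) hc).mul_right C) fun i => ?_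
  rw [norm_mul, norm_pow, Real.norm_eq_abs]
  gcongr
  exact hC _ (Set.mem_range_self (x i))

theorem hasSum_pow_mul_sub {c : ℝ} {u : ℕ → ℝ} (hu : Summable fun i => c ^ i * u i) :
    HasSum (fun i => c ^ i * (u i - c * u (i + 1))) (u 0) := by
  have hshift : HasSum (fun i => c ^ (i + 1) * u (i + 1)) ((∑' i, c ^ i * u i) - u 0) := by
    simpa using (hasSum_nat_add_iff' (f := fun i => c ^ i * u i) 1).2 hu.hasSum
  simpa [mul_sub, pow_succ, mul_assoc] using hu.hasSum.sub hshift

theorem discSum_const_mul (c : ℝ) (ε : ℚ) (v : ℕ → ℚ) :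
    discSum c (fun i => ε * v i) = ε * discSum c v := by
  simp only [discSum, Rat.cast_mul, mul_left_comm _ (ε : ℝ), tsum_mul_left]

variable {Q S : Type*} {E : Q → S → Q → Prop} {W : Q → S → Q → ℚ} {c : ℚ} {V : Q → ℚ}

theorem IsMaxPotential.isGreatest_discSum [Finite Q] [Finite S] (hV : IsMaxPotential E W c V)
    (hc : |(c : ℝ)| < 1) (h0 : 0 ≤ c) (q : Q) :
    IsGreatest {x | ∃ (w : ℕ → S) (r : ℕ → Q), r 0 = q ∧ (∀ i, E (r i) (w i) (r (i + 1))) ∧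
      discSum c (fun i => W (r i) (w i) (r (i + 1))) = x} (V q : ℝ) := by
  have htelescope (r : ℕ → Q) :
      HasSum (fun i => (c : ℝ) ^ i * (V (r i) - c * V (r (i + 1)))) (V (r 0)) :=
    hasSum_pow_mul_sub (summable_pow_mul_comp hc (fun q => (V q : ℝ)) r)
  constructor
  · obtain ⟨w, r, rfl, hr, hVr⟩ := hV.exists_path q
    refine ⟨w, r, rfl, hr, Eq.trans (tsum_congr fun i => ?_) (htelescope r).tsum_eq⟩
    rw [hVr i]
    push_cast
    ring
  · rintro _ ⟨w, r, rfl, hr, rfl⟩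
    refine ((summable_pow_mul_comp hc (fun e : Q × S × Q => (W e.1 e.2.1 e.2.2 : ℝ))
      fun i => (r i, w i, r (i + 1))).tsum_le_tsum (fun i => ?_) (htelescope r).summable).trans_eq
        (htelescope r).tsum_eq
    have := hV.1 _ _ _ (hr i)
    gcongr
    exact le_sub_iff_add_le.2 (mod_cast this)

end DiscountedSum

/-! ### Extrema over the support of a measure -/

section Support

variable {X : Type*} [TopologicalSpace X] [HereditarilyLindelofSpace X] [MeasurableSpace X]
  {μ : Measure X} {f : X → ℝ} {η ν : ℝ}

theorem measure_support_inter_le_pos (hf : Continuous f) {x₀ : X} (hx₀ : x₀ ∈ μ.support)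
    (hη : η < f x₀) : 0 < μ {x | x ∈ μ.support ∧ η ≤ f x} := by
  have hpos : 0 < μ {x | η ≤ f x} := (Measure.mem_support_iff_forall x₀).1 hx₀ _
    (hf.continuousAt.eventually (eventually_ge_nhds hη))
  rwa [← measure_inter_conull (mem_ae_iff.1 Measure.support_mem_ae), Set.inter_comm] at hpos

theorem measure_support_inter_le_eq_one_iff [OpensMeasurableSpace X] [IsProbabilityMeasure μ]
    (hf : Continuous f) : μ {x | x ∈ μ.support ∧ η ≤ f x} = 1 ↔ ∀ x ∈ μ.support, η ≤ f x := by
  have hclosed : IsClosed {x | x ∈ μ.support ∧ η ≤ f x} :=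
    Measure.isClosed_support.inter (isClosed_le continuous_const hf)
  rw [← mem_ae_iff_prob_eq_one hclosed.measurableSet]
  exact ⟨fun h x hx => (Measure.support_subset_of_isClosed hclosed h hx).2,
    fun h => Filter.mem_of_superset Measure.support_mem_ae fun x hx => ⟨hx, h x hx⟩⟩

theorem le_sSup_measure_pos_iff [CompactSpace X] (hμ : μ ≠ 0) (hf : Continuous f) :
    ν ≤ sSup {η | 0 < μ {x | x ∈ μ.support ∧ η ≤ f x}} ↔ ∃ x ∈ μ.support, ν ≤ f x := by
  obtain ⟨x₀, hx₀, hmax⟩ := Measure.isClosed_support.isCompact.exists_isMaxOn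
    (Measure.nonempty_support hμ) hf.continuousOn
  have hsup : sSup {η | 0 < μ {x | x ∈ μ.support ∧ η ≤ f x}} = f x₀ := by
    refine csSup_eq_of_forall_le_of_forall_lt_exists_gt
      ⟨f x₀ - 1, measure_support_inter_le_pos hf hx₀ (sub_one_lt _)⟩ (fun η hη => ?_)
      fun η hη => (exists_between hη).imp fun η' h =>
        ⟨measure_support_inter_le_pos hf hx₀ h.2, h.1⟩
    obtain ⟨x, hx, hle⟩ := nonempty_of_measure_ne_zero (hη : 0 < μ _).ne'
    exact hle.trans (hmax hx)
  rw [hsup]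
  exact ⟨fun h => ⟨x₀, hx₀, h⟩, fun ⟨x, hx, h⟩ => h.trans (hmax hx)⟩

theorem le_sSup_measure_eq_one_iff [CompactSpace X] [OpensMeasurableSpace X]
    [IsProbabilityMeasure μ] (hf : Continuous f) :
    ν ≤ sSup {η | μ {x | x ∈ μ.support ∧ η ≤ f x} = 1} ↔ ∀ x ∈ μ.support, ν ≤ f x := by
  obtain ⟨x₀, hx₀, hmin⟩ := Measure.isClosed_support.isCompact.exists_isMinOn
    (Measure.nonempty_support (IsProbabilityMeasure.ne_zero μ)) hf.continuousOn
  have hgreatest : IsGreatest {η | μ {x | x ∈ μ.support ∧ η ≤ f x} = 1} (f x₀) :=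
    ⟨(measure_support_inter_le_eq_one_iff hf).2 fun x hx => hmin hx,
      fun η hη => (measure_support_inter_le_eq_one_iff hf).1 hη x₀ hx₀⟩
  rw [hgreatest.csSup_eq]
  exact ⟨fun h x hx => h.trans (hmin hx), fun h => h x₀ hx₀⟩

end Support

/-! ### The support of the run measure -/

theorem hasBasis_nhds_cylinder {Q : Type*} [TopologicalSpace Q] [DiscreteTopology Q] (s : ℕ → Q) :
    (nhds s).HasBasis (fun _ : ℕ => True) fun k => {r | ∀ i ≤ k, r i = s i} := by
  have hbasis := PiNat.isTopologicalBasis_cylinders fun _ : ℕ => Q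
  refine ⟨fun t => ⟨fun ht => ?_, fun ⟨k, _, hk⟩ => Filter.mem_of_superset ?_ hk⟩⟩
  · obtain ⟨_, ⟨x, n, rfl⟩, hs, ht⟩ := hbasis.mem_nhds_iff.1 ht
    rw [← PiNat.mem_cylinder_iff_eq.1 hs] at ht
    exact ⟨n, trivial, fun r hr => ht (PiNat.mem_cylinder_iff.2 fun i hi => hr i hi.le)⟩
  · have hcyl : PiNat.cylinder s (k + 1) ⊆ {r | ∀ i ≤ k, r i = s i} := fun r hr i hi =>
      hr i (Nat.lt_succ_of_le hi)
    exact Filter.mem_of_superset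
      ((PiNat.isOpen_cylinder _ s (k + 1)).mem_nhds (PiNat.self_mem_cylinder s _)) hcyl

namespace ProbWeightedAutomaton

variable {Q S : Type*} [Fintype Q]

theorem isRun_iff_forall_prod_pos (A : ProbWeightedAutomaton Q S) (w : ℕ → S) (r : ℕ → Q) :
    A.IsRun w r ↔
      ∀ k, 0 < A.init (r 0) * ∏ i ∈ Finset.range k, A.trans (r i) (w i) (r (i + 1)) := by
  refine ⟨fun h k => mul_pos h.1 (Finset.prod_pos fun i _ => h.2 i),
    fun h => ⟨by simpa using h 0, fun i => ?_⟩⟩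
  have hi := h (i + 1)
  rw [Finset.prod_range_succ, ← mul_assoc] at hi
  exact (pos_iff_pos_of_mul_pos hi).1 (h i)

instance [MeasurableSpace Q] [DiscreteMeasurableSpace Q] (A : ProbWeightedAutomaton Q S)
    (w : ℕ → S) :
    IsProbabilityMeasure (A.runMeasure w) := by
  have : IsProbabilityMeasure (pmfOfSimplex A.init A.init_mem).toMeasure := inferInstance
  unfold runMeasure
  infer_instance

section Topology

variable [TopologicalSpace Q] [DiscreteTopology Q]

theorem continuous_discSum_weights [Finite S] (A : ProbWeightedAutomaton Q S) {c : ℝ}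
    (hc : |c| < 1) (w : ℕ → S) : Continuous fun r => discSum c (A.weights w r) := by
  obtain ⟨C, hC⟩ := (Set.finite_range fun e : Q × S × Q => (A.weight e.1 e.2.1 e.2.2 : ℝ)).isBounded
    |>.exists_norm_le
  refine continuous_tsum (u := fun i => |c| ^ i * C) (fun i => ?_)
    ((summable_geometric_of_lt_one (abs_nonneg c) hc).mul_right C) fun i r => ?_
  · have hweight : Continuous fun e : Q × Q => (A.weight e.1 (w i) e.2 : ℝ) :=
      continuous_of_discreteTopology
    have hstep : Continuous fun r : ℕ → Q => (r i, r (i + 1)) := by fun_prop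
    exact continuous_const.mul (hweight.comp hstep)
  · rw [norm_mul, norm_pow, Real.norm_eq_abs]
    gcongr
    exact hC _ ⟨(r i, w i, r (i + 1)), rfl⟩

variable [MeasurableSpace Q] [DiscreteMeasurableSpace Q]

theorem mem_support_runMeasure_iff (A : ProbWeightedAutomaton Q S) (w : ℕ → S) (r : ℕ → Q) :
    r ∈ (A.runMeasure w).support ↔ A.IsRun w r := by
  simp only [(hasBasis_nhds_cylinder r).mem_measureSupport, runMeasure_cylinder,
    ENNReal.ofReal_pos, true_imp_iff, isRun_iff_forall_prod_pos]

variable {Val : (ℕ → ℚ) → ℝ} {ν : ℝ}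

theorem le_posValue_iff (A : ProbWeightedAutomaton Q S) (w : ℕ → S)
    (hVal : Continuous fun r => Val (A.weights w r)) :
    ν ≤ A.posValue Val w ↔ ∃ r, A.IsRun w r ∧ ν ≤ Val (A.weights w r) := by
  simp only [posValue, ← mem_support_runMeasure_iff]
  exact le_sSup_measure_pos_iff (IsProbabilityMeasure.ne_zero _) hVal

theorem le_asValue_iff (A : ProbWeightedAutomaton Q S) (w : ℕ → S)
    (hVal : Continuous fun r => Val (A.weights w r)) :
    ν ≤ A.asValue Val w ↔ ∀ r, A.IsRun w r → ν ≤ Val (A.weights w r) := by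
  have : OpensMeasurableSpace Q := ⟨fun _ _ => .of_discrete⟩
  simp only [asValue, ← mem_support_runMeasure_iff]
  exact le_sSup_measure_eq_one_iff hVal

end Topology

end ProbWeightedAutomaton

/-! ### Optimal potentials of an instance -/

namespace DiscInstance

theorem automaton_isRun_iff {x : DiscInstance} {w : ℕ → Fin x.numLetters}
    {r : ℕ → Fin x.numStates} : x.automaton.IsRun w r ↔
      0 < x.init (r 0) ∧ ∀ i, 0 < x.trans (r i) (w i) (r (i + 1)) := by
  simp [ProbWeightedAutomaton.IsRun, automaton]

variable (x : DiscInstance)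

theorem abs_discount_lt_one : |(x.discount : ℝ)| < 1 := by
  rw [abs_of_pos (mod_cast x.discount_pos)]
  exact_mod_cast x.discount_lt_one

theorem posNonempty_iff_exists_isRun : x.PosNonempty ↔
    ∃ w r, x.automaton.IsRun w r ∧ x.threshold ≤ discSum x.discount (x.automaton.weights w r) :=
  exists_congr fun w => x.automaton.le_posValue_iff w
    (x.automaton.continuous_discSum_weights x.abs_discount_lt_one w)

theorem asUniversal_iff_forall_isRun : x.AsUniversal ↔
    ∀ w r, x.automaton.IsRun w r → x.threshold ≤ discSum x.discount (x.automaton.weights w r) :=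
  forall_congr' fun w => x.automaton.le_asValue_iff w
    (x.automaton.continuous_discSum_weights x.abs_discount_lt_one w)

/-- `U` is the vector of the optimal values, over all words, of the discounted sum of the weights
scaled by `ε`: the maximal discounted sums from each state for `ε = 1`, and the negated minimal ones
for `ε = -1`. -/
def IsOptimalPotential (ε : ℚ) (U : Fin x.numStates → ℚ) : Prop :=
  IsMaxPotential (fun q a q' => 0 < x.trans q a q') (fun q a q' => ε * x.weight q a q') x.discount U

theorem exists_trans_pos (q : Fin x.numStates) (a : Fin x.numLetters) :
    ∃ q', 0 < x.trans q a q' := by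
  by_contra! h
  exact ((Finset.sum_nonpos fun q' _ => h q').trans_lt one_pos).ne (x.trans_mem q a).2

theorem exists_isOptimalPotential (h : 0 < x.numLetters) (ε : ℚ) :
    ∃ U, x.IsOptimalPotential ε U :=
  exists_isMaxPotential x.discount_pos.le x.discount_lt_one _
    fun q => ⟨⟨0, h⟩, x.exists_trans_pos q _⟩

variable {x} {U : Fin x.numStates → ℚ}

theorem IsOptimalPotential.isGreatest {ε : ℚ} (hU : x.IsOptimalPotential ε U)
    (q : Fin x.numStates) :
    IsGreatest {y | ∃ w r, r 0 = q ∧ (∀ i, 0 < x.trans (r i) (w i) (r (i + 1))) ∧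
      ε * discSum x.discount (x.automaton.weights w r) = y} (U q : ℝ) := by
  simp only [← discSum_const_mul]
  exact IsMaxPotential.isGreatest_discSum hU x.abs_discount_lt_one x.discount_pos.le q

theorem posNonempty_iff (hU : 0 < x.numLetters → x.IsOptimalPotential 1 U) :
    x.PosNonempty ↔ 0 < x.numLetters ∧ ∃ q, 0 < x.init q ∧ x.threshold ≤ U q := by
  simp only [posNonempty_iff_exists_isRun, automaton_isRun_iff]
  constructor
  · rintro ⟨w, r, ⟨hinit, hr⟩, hle⟩
    have hle' := ((hU (w 0).pos).isGreatest (r 0)).2 ⟨w, r, rfl, hr, rfl⟩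
    rw [Rat.cast_one, one_mul] at hle'
    exact ⟨(w 0).pos, r 0, hinit, mod_cast hle.trans hle'⟩
  · rintro ⟨hpos, q, hinit, hle⟩
    obtain ⟨w, r, rfl, hr, heq⟩ := ((hU hpos).isGreatest q).1
    rw [Rat.cast_one, one_mul] at heq
    exact ⟨w, r, ⟨hinit, hr⟩, heq ▸ mod_cast hle⟩

theorem asUniversal_iff (hU : 0 < x.numLetters → x.IsOptimalPotential (-1) U) :
    x.AsUniversal ↔ (0 < x.numLetters → ∀ q, 0 < x.init q → x.threshold ≤ -U q) := by
  simp only [asUniversal_iff_forall_isRun, automaton_isRun_iff]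
  constructor
  · intro h hpos q hinit
    obtain ⟨w, r, rfl, hr, heq⟩ := ((hU hpos).isGreatest q).1
    rw [Rat.cast_neg, Rat.cast_one, neg_one_mul, neg_eq_iff_eq_neg] at heq
    exact_mod_cast heq ▸ h w r ⟨hinit, hr⟩
  · rintro h w r ⟨hinit, hr⟩
    have hle := ((hU (w 0).pos).isGreatest (r 0)).2 ⟨w, r, rfl, hr, rfl⟩
    rw [Rat.cast_neg, Rat.cast_one, neg_one_mul, neg_le] at hle
    exact le_trans (mod_cast h (w 0).pos _ hinit) hle

end DiscInstance

/-! ### Reading and checking codes -/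

/-- The rational number with the given, not necessarily reduced, numerator and denominator. -/
def ratOfCode (p : ℤ × ℕ) : ℚ := mkRat p.1 p.2

@[simp]
theorem ratOfCode_ratCode (x : ℚ) : ratOfCode (ratCode x) = x := Rat.mkRat_self x

theorem primrec_ratOfCode : Primrec ratOfCode := primrec_mkRat.comp .fst .snd

/-- The entry of the table of a rational function on `Q × S × Q` at the given indices, `0` if these
are out of range. -/
def tableEntry (t : List (List (List (ℤ × ℕ)))) (q a q' : ℕ) : ℚ :=
  ratOfCode (((t.getD q []).getD a []).getD q' (0, 1))

@[simp]
theorem tableEntry_tableCode {n m : ℕ} (t : Fin n → Fin m → Fin n → ℚ) (q : Fin n) (a : Fin m)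
    (q' : Fin n) : tableEntry (tableCode t) q a q' = t q a q' := by
  simp [tableEntry, tableCode]

namespace DiscCode

/-- The number of states. -/
def numStates (c : DiscCode) : ℕ := c.1.1

/-- The number of letters. -/
def numLetters (c : DiscCode) : ℕ := c.1.2

/-- The initial probability of a state, `0` if the state is out of range. -/
def initAt (c : DiscCode) (q : ℕ) : ℚ := ratOfCode (c.2.1.1.getD q (0, 1))

/-- The transition probabilities, `0` if the indices are out of range. -/
def transAt (c : DiscCode) : ℕ → ℕ → ℕ → ℚ := tableEntry c.2.1.2.1

/-- The weights, `0` if the indices are out of range. -/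
def weightAt (c : DiscCode) : ℕ → ℕ → ℕ → ℚ := tableEntry c.2.1.2.2

/-- The discount factor. -/
def discount (c : DiscCode) : ℚ := ratOfCode c.2.2.1

/-- The threshold. -/
def threshold (c : DiscCode) : ℚ := ratOfCode c.2.2.2

/-- The code with the same entries in which all lists have the right length and all fractions are
reduced. -/
def normalize (c : DiscCode) : DiscCode :=
  ((c.numStates, c.numLetters),
    (List.ofFn fun q : Fin c.numStates => ratCode (c.initAt q),
      tableCode fun (q : Fin c.numStates) (a : Fin c.numLetters) q' => c.transAt q a q',
      tableCode fun (q : Fin c.numStates) (a : Fin c.numLetters) q' => c.weightAt q a q'),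
    (ratCode c.discount, ratCode c.threshold))

/-- The codes of instances: normalized, with probability vectors where these are required, and with
a discount factor in `(0, 1)`. -/
def IsValid (c : DiscCode) : Prop :=
  c.normalize = c ∧ (fun q : Fin c.numStates => c.initAt q) ∈ stdSimplex ℚ (Fin c.numStates) ∧
    (∀ (q : Fin c.numStates) (a : Fin c.numLetters),
      (fun q' : Fin c.numStates => c.transAt q a q') ∈ stdSimplex ℚ (Fin c.numStates)) ∧
    0 < c.discount ∧ c.discount < 1

/-- The condition `DiscInstance.IsOptimalPotential` read off a code, with the potential given as the
list of its values. -/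
def IsOptimalPotential (ε : ℚ) (c : DiscCode) (U : List ℚ) : Prop :=
  IsMaxPotential (fun (q : Fin c.numStates) (a : Fin c.numLetters) (q' : Fin c.numStates) =>
    0 < c.transAt q a q') (fun q a q' => ε * c.weightAt q a q') c.discount fun q => U.getD q 0

section Encode

variable (x : DiscInstance)

theorem initAt_encode (q : Fin x.numStates) : initAt x.encode q = x.init q := by
  simp [initAt, DiscInstance.encode]

theorem transAt_encode (q : Fin x.numStates) (a : Fin x.numLetters) (q' : Fin x.numStates) :
    transAt x.encode q a q' = x.trans q a q' :=
  tableEntry_tableCode x.trans q a q'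

theorem weightAt_encode (q : Fin x.numStates) (a : Fin x.numLetters) (q' : Fin x.numStates) :
    weightAt x.encode q a q' = x.weight q a q' :=
  tableEntry_tableCode x.weight q a q'

theorem discount_encode : discount x.encode = x.discount := ratOfCode_ratCode _

theorem threshold_encode : threshold x.encode = x.threshold := ratOfCode_ratCode _

theorem normalize_encode : normalize x.encode = x.encode := by
  refine Prod.ext rfl (Prod.ext (Prod.ext ?_ (Prod.ext ?_ ?_)) (Prod.ext ?_ ?_))
  · exact congrArg List.ofFn (funext fun q => congrArg ratCode (initAt_encode x q))
  · exact congrArg tableCode (funext₃ (transAt_encode x))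
  · exact congrArg tableCode (funext₃ (weightAt_encode x))
  · exact congrArg ratCode (discount_encode x)
  · exact congrArg ratCode (threshold_encode x)

theorem isValid_encode : IsValid x.encode := by
  refine ⟨normalize_encode x, ?_, fun q a => ?_, ?_, ?_⟩
  · exact (funext (initAt_encode x)).symm ▸ x.init_mem
  · exact (funext (transAt_encode x q a)).symm ▸ x.trans_mem q a
  · exact discount_encode x ▸ x.discount_pos
  · exact discount_encode x ▸ x.discount_lt_one

theorem isOptimalPotential_encode {ε : ℚ} {U : List ℚ} :
    IsOptimalPotential ε x.encode U ↔ x.IsOptimalPotential ε fun q => U.getD q 0 := by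
  have htrans : (fun (q : Fin x.numStates) (a : Fin x.numLetters) (q' : Fin x.numStates) =>
      0 < transAt x.encode q a q') = fun q a q' => 0 < x.trans q a q' := by
    simp only [transAt_encode]
  have hweight : (fun (q : Fin x.numStates) (a : Fin x.numLetters) (q' : Fin x.numStates) =>
      ε * weightAt x.encode q a q') = fun q a q' => ε * x.weight q a q' := by
    simp only [weightAt_encode]
  rw [DiscInstance.IsOptimalPotential, ← htrans, ← hweight, ← discount_encode]
  rfl

end Encode

theorem IsValid.exists_encode_eq {c : DiscCode} (hc : c.IsValid) :
    ∃ x : DiscInstance, x.encode = c :=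
  ⟨⟨c.numStates, c.numLetters, fun q => c.initAt q, hc.2.1, fun q a q' => c.transAt q a q',
    hc.2.2.1, fun q a q' => c.weightAt q a q', c.discount, hc.2.2.2.1, hc.2.2.2.2, c.threshold⟩,
    hc.1⟩

section Primrec

theorem primrec_numStates : Primrec numStates := Primrec.fst.comp .fst

theorem primrec_numLetters : Primrec numLetters := Primrec.snd.comp .fst

theorem primrecPred_numLetters_pos : PrimrecPred fun c : DiscCode => 0 < c.numLetters :=
  Primrec.nat_lt.comp (.const 0) primrec_numLetters

theorem primrec_discount : Primrec discount :=
  primrec_ratOfCode.comp (Primrec.fst.comp (Primrec.snd.comp .snd))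

theorem primrec_threshold : Primrec threshold :=
  primrec_ratOfCode.comp (Primrec.snd.comp (Primrec.snd.comp .snd))

theorem primrec_initAt : Primrec₂ initAt :=
  primrec_ratOfCode.comp ((Primrec.list_getD _).comp
    (Primrec.fst.comp (Primrec.fst.comp (Primrec.snd.comp .fst))) .snd)

variable {α : Type*} [Primcodable α] {f : α → DiscCode} {q a q' : α → ℕ}

theorem primrec_tableEntry {t : α → List (List (List (ℤ × ℕ)))} (ht : Primrec t) (hq : Primrec q)
    (ha : Primrec a) (hq' : Primrec q') :
    Primrec fun x => tableEntry (t x) (q x) (a x) (q' x) :=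
  primrec_ratOfCode.comp ((Primrec.list_getD _).comp ((Primrec.list_getD _).comp
    ((Primrec.list_getD _).comp ht hq) ha) hq')

theorem primrec_transAt (hf : Primrec f) (hq : Primrec q) (ha : Primrec a) (hq' : Primrec q') :
    Primrec fun x => transAt (f x) (q x) (a x) (q' x) :=
  primrec_tableEntry (Primrec.fst.comp (Primrec.snd.comp (Primrec.fst.comp (Primrec.snd.comp hf))))
    hq ha hq'

theorem primrec_weightAt (hf : Primrec f) (hq : Primrec q) (ha : Primrec a) (hq' : Primrec q') :
    Primrec fun x => weightAt (f x) (q x) (a x) (q' x) :=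
  primrec_tableEntry (Primrec.snd.comp (Primrec.snd.comp (Primrec.fst.comp (Primrec.snd.comp hf))))
    hq ha hq'

theorem primrec_tableCode {n m : α → ℕ} {t : α → ℕ → ℕ → ℕ → ℚ} (hn : Primrec n) (hm : Primrec m)
    (ht : Primrec fun p : ((α × ℕ) × ℕ) × ℕ => t p.1.1.1 p.1.1.2 p.1.2 p.2) :
    Primrec fun x => tableCode fun (q : Fin (n x)) (a : Fin (m x)) (q' : Fin (n x)) =>
      t x q a q' :=
  primrec_list_ofFn hn (primrec_list_ofFn (hm.comp .fst)
    (primrec_list_ofFn (hn.comp (Primrec.fst.comp .fst)) (primrec_ratCode.comp ht).to₂).to₂).to₂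

end Primrec

theorem primrec_normalize : Primrec normalize := by
  have hc := Primrec.fst.comp (Primrec.fst.comp (Primrec.fst (α := (DiscCode × ℕ) × ℕ) (β := ℕ)))
  have hq := Primrec.snd.comp (Primrec.fst.comp (Primrec.fst (α := (DiscCode × ℕ) × ℕ) (β := ℕ)))
  have ha := Primrec.snd.comp (Primrec.fst (α := (DiscCode × ℕ) × ℕ) (β := ℕ))
  exact .pair (.pair primrec_numStates primrec_numLetters) (.pair
    (.pair (primrec_list_ofFn primrec_numStates (primrec_ratCode.comp₂ primrec_initAt)) (.pair
      (primrec_tableCode primrec_numStates primrec_numLetters (primrec_transAt hc hq ha .snd))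
      (primrec_tableCode primrec_numStates primrec_numLetters (primrec_weightAt hc hq ha .snd))))
    (.pair (primrec_ratCode.comp primrec_discount) (primrec_ratCode.comp primrec_threshold)))

theorem primrecPred_isValid : PrimrecPred IsValid := by
  refine (Primrec.eq.comp primrec_normalize .id).and
    ((primrecPred_mem_stdSimplex primrec_numStates primrec_initAt).and (.and ?_
      ((primrecRel_rat_lt.comp (.const 0) primrec_discount).and
        (primrecRel_rat_lt.comp primrec_discount (.const 1)))))
  exact primrecPred_forall_fin primrec_numStates <|
    primrecPred_forall_fin (primrec_numLetters.comp .fst) <|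
    primrecPred_mem_stdSimplex (f := fun (p : (DiscCode × ℕ) × ℕ) q' =>
      transAt p.1.1 p.1.2 p.2 q') (primrec_numStates.comp (Primrec.fst.comp .fst))
      (primrec_transAt (Primrec.fst.comp (Primrec.fst.comp .fst))
        (Primrec.snd.comp (Primrec.fst.comp .fst)) (Primrec.snd.comp .fst) .snd)

theorem primrecRel_isOptimalPotential (ε : ℚ) : PrimrecRel (IsOptimalPotential ε) := by
  let edge (p : ((DiscCode × List ℚ) × ℕ) × ℕ) (q' : ℕ) : Prop :=
    0 < p.1.1.1.transAt p.1.2 p.2 q'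
  let source (p : ((DiscCode × List ℚ) × ℕ) × ℕ) : ℚ := p.1.1.2.getD p.1.2 0
  let step (p : ((DiscCode × List ℚ) × ℕ) × ℕ) (q' : ℕ) : ℚ :=
    ε * p.1.1.1.weightAt p.1.2 p.2 q' + p.1.1.1.discount * p.1.1.2.getD q' 0
  have hc : Primrec fun p : ((DiscCode × List ℚ) × ℕ) × ℕ => p.1.1.1 :=
    Primrec.fst.comp (Primrec.fst.comp .fst)
  have hU : Primrec fun p : ((DiscCode × List ℚ) × ℕ) × ℕ => p.1.1.2 :=
    Primrec.snd.comp (Primrec.fst.comp .fst)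
  have hq : Primrec fun p : ((DiscCode × List ℚ) × ℕ) × ℕ => p.1.2 := Primrec.snd.comp .fst
  have hedge : PrimrecRel edge := primrecRel_rat_lt.comp (.const 0)
    (primrec_transAt (hc.comp .fst) (hq.comp .fst) (Primrec.snd.comp .fst) .snd)
  have hsource : Primrec source := (Primrec.list_getD 0).comp hU hq
  have hstep : Primrec₂ step := primrec_rat_add.comp
    (primrec_rat_mul.comp (.const ε)
      (primrec_weightAt (hc.comp .fst) (hq.comp .fst) (Primrec.snd.comp .fst) .snd))
    (primrec_rat_mul.comp (primrec_discount.comp (hc.comp .fst))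
      ((Primrec.list_getD 0).comp (hU.comp .fst) .snd))
  have hle : PrimrecRel fun p q' => edge p q' → step p q' ≤ source p :=
    primrecPred_imp hedge (primrecRel_rat_le.comp hstep (hsource.comp .fst))
  have heq : PrimrecRel fun p q' => edge p q' ∧ source p = step p q' :=
    hedge.and (Primrec.eq.comp (hsource.comp .fst) hstep)
  have hn : Primrec fun p : DiscCode × List ℚ => p.1.numStates := primrec_numStates.comp .fst
  have hm : Primrec fun p : (DiscCode × List ℚ) × ℕ => p.1.1.numLetters :=
    primrec_numLetters.comp (Primrec.fst.comp .fst)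
  have hn' := primrec_numStates.comp hc
  exact (primrecPred_forall_fin hn (primrecPred_forall_fin hm (primrecPred_forall_fin hn' hle))).and
    (primrecPred_forall_fin hn (primrecPred_exists_fin hm (primrecPred_exists_fin hn' heq)))

end DiscCode

theorem DiscInstance.decidableProblem_of_isOptimalPotential {P : DiscInstance → Prop}
    {T : DiscCode → List ℚ → Prop} (ε : ℚ) (hT : PrimrecRel T)
    (h : ∀ (x : DiscInstance) (U : List ℚ),
      (0 < x.numLetters → x.IsOptimalPotential ε fun q => U.getD q 0) → (P x ↔ T x.encode U)) :
    DecidableProblem P := by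
  have hvalid : PrimrecPred fun p : DiscCode × List ℚ => p.1.IsValid :=
    DiscCode.primrecPred_isValid.comp .fst
  have hletters : PrimrecPred fun p : DiscCode × List ℚ => 0 < p.1.numLetters :=
    DiscCode.primrecPred_numLetters_pos.comp .fst
  refine computablePred_of_search
    (R := fun c U => c.IsValid → 0 < c.numLetters → c.IsOptimalPotential ε U)
    (T := fun c U => c.IsValid ∧ T c U)
    (primrecPred_imp hvalid (primrecPred_imp hletters (DiscCode.primrecRel_isOptimalPotential ε)))
    (hvalid.and hT) (fun c => ?_) fun c U hU => ⟨?_, fun ⟨hc, hTU⟩ => ?_⟩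
  · by_cases hc : c.IsValid ∧ 0 < c.numLetters
    · obtain ⟨x, rfl⟩ := hc.1.exists_encode_eq
      obtain ⟨V, hV⟩ := x.exists_isOptimalPotential hc.2 ε
      exact ⟨List.ofFn V, fun _ _ => (DiscCode.isOptimalPotential_encode x).2 (by simpa using hV)⟩
    · exact ⟨[], fun h₁ h₂ => absurd ⟨h₁, h₂⟩ hc⟩
  · rintro ⟨x, rfl, hx⟩
    have hx' := DiscCode.isValid_encode x
    exact ⟨hx', (h x U fun hm => (DiscCode.isOptimalPotential_encode x).1 (hU hx' hm)).1 hx⟩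
  · obtain ⟨x, rfl⟩ := hc.exists_encode_eq
    exact ⟨x, rfl,
      (h x U fun hm => (DiscCode.isOptimalPotential_encode x).1 (hU hc hm)).2 hTU⟩

namespace DiscCode

/-- The test for `DiscInstance.PosNonempty` on the list `U` of the maximal discounted sums from each
state. If there are no letters, then there is no word. -/
def PosTest (c : DiscCode) (U : List ℚ) : Prop :=
  0 < c.numLetters ∧ ∃ q : Fin c.numStates, 0 < c.initAt q ∧ c.threshold ≤ U.getD q 0

/-- The test for `DiscInstance.AsUniversal` on the list `U` of the negated minimal discounted sums
from each state. If there are no letters, then there is no word. -/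
def AsTest (c : DiscCode) (U : List ℚ) : Prop :=
  0 < c.numLetters → ∀ q : Fin c.numStates, 0 < c.initAt q → c.threshold + U.getD q 0 ≤ 0

theorem posTest_encode {x : DiscInstance} {U : List ℚ} : PosTest x.encode U ↔
    0 < x.numLetters ∧ ∃ q : Fin x.numStates, 0 < x.init q ∧ x.threshold ≤ U.getD q 0 := by
  rw [← threshold_encode]
  simp only [← initAt_encode]
  rfl

theorem asTest_encode {x : DiscInstance} {U : List ℚ} : AsTest x.encode U ↔
    (0 < x.numLetters → ∀ q : Fin x.numStates, 0 < x.init q → x.threshold ≤ -U.getD q 0) := by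
  rw [← threshold_encode]
  simp only [← initAt_encode, le_neg_iff_add_nonpos_right]
  rfl

theorem primrecRel_posTest : PrimrecRel PosTest :=
  (primrecPred_numLetters_pos.comp .fst).and <|
    primrecPred_exists_fin (primrec_numStates.comp .fst) <|
      (primrecRel_rat_lt.comp (.const 0) (primrec_initAt.comp (Primrec.fst.comp .fst) .snd)).and <|
        primrecRel_rat_le.comp (primrec_threshold.comp (Primrec.fst.comp .fst))
          ((Primrec.list_getD 0).comp (Primrec.snd.comp .fst) .snd)

theorem primrecRel_asTest : PrimrecRel AsTest :=
  primrecPred_imp (primrecPred_numLetters_pos.comp .fst) <|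
    primrecPred_forall_fin (primrec_numStates.comp .fst) <| primrecPred_imp
      (primrecRel_rat_lt.comp (.const 0) (primrec_initAt.comp (Primrec.fst.comp .fst) .snd)) <|
        primrecRel_rat_le.comp (primrec_rat_add.comp
          (primrec_threshold.comp (Primrec.fst.comp .fst))
          ((Primrec.list_getD 0).comp (Primrec.snd.comp .fst) .snd)) (.const 0)

end DiscCode

theorem mainTheorem11 :
    DiscInstance.DecidableProblem DiscInstance.PosNonempty ∧
      DiscInstance.DecidableProblem DiscInstance.AsUniversal := by
  refine ⟨DiscInstance.decidableProblem_of_isOptimalPotential 1 DiscCode.primrecRel_posTest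
      fun x U hU => ?_,
    DiscInstance.decidableProblem_of_isOptimalPotential (-1) DiscCode.primrecRel_asTest
      fun x U hU => ?_⟩
  · rw [DiscInstance.posNonempty_iff hU, DiscCode.posTest_encode]
  · rw [DiscInstance.asUniversal_iff hU, DiscCode.asTest_encode]
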